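/- Let $q=e^{\eta}$ with $\operatorname{Re}\eta<0$ (so $0<|q|<1$), write $q^x=e^{\eta x}$, and attach an arbitrary complex number $c^{n\pm}$ to each point $n^+,n^-$ ($n\in\mathbb Z$) of a one-dimensional lattice. To the point $n^\pm$ attach variables $e^{\pm\alpha_0},e^{\pm\alpha_1}$ and the operators $E_i=-(q-q^{-1})e^{\pm\alpha_i}$ (multiplication; $i=0,1$), $\Delta^{n\pm}=E_0E_1$, the derivations $h_1$ and $d$ with $[h_1,e^{\pm\alpha_1}]=\pm2e^{\pm\alpha_1}$, $[h_1,e^{\pm\alpha_0}]=\mp2e^{\pm\alpha_0}$, $[d,e^{\pm\alpha_0}]=\pm e^{\pm\alpha_0}$, $[d,e^{\pm\alpha_1}]=0$, the operator $h_0=c^{n\pm}-h_1$, and $k_i=q^{h_i}$. All these operators act on the space of formal Laurent series in the variables of all lattice points with exponents bounded below by a finitely supported exponent; a superscript or tensor factor tells at which point an operator acts. With $(x,Q)_\infty=\prod_{n\ge0}(1-xQ^n)$ let $$R^{m^+n^-}=(qE_1\otimes E_1,q^2)_\infty^{-1}\,(q^2\Delta^{m+}\otimes\Delta^{n-},q^4)_\infty^{-1}\,(qE_0\otimes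 E_0,q^2)_\infty^{-1}\,q^{-\left(\frac12h_1\otimes h_1+c^{m+}\otimes d+d\otimes c^{n-}\right)},$$ where the first tensor factor acts at $m^+$ and the second at $n^-$. Let $\mathcal H_0=\prod_nR^{n^+n^-}$, $\mathcal H_1=\prod_nR^{(n+1)^+n^-}$, $\mathcal H=\mathcal H_0\mathcal H_1$, and consider the dynamics $\mathcal T(\mathcal O)=\mathcal H^{-1}\mathcal O\mathcal H$ (the non-autonomous quantized Faddeev–Volkov dynamics). Put $$w_i(m^+n^-)=\begin{cases}E_i^{m+}\otimes E_i^{n-}&(m\equiv n\bmod 2),\\ (E_ik_i^{-1})^{m+}\otimes(k_iE_i)^{n-}&(\text{otherwise}),\end{cases}\qquad \Delta(m^+n^-)=\begin{cases}\Delta^{m+}\otimes\Delta^{n-}&(m\equiv n\bmod 2),\\ q^{c^{n-}-c^{m+}}\,\Delta^{m+}\otimes\Delta^{n-}&(\text{otherwise}).\end{cases}$$ **Theorem.** The operators $R^{m^+n^-}$ are well defined and invertible; the infinite products $\mathcal H_0,\mathcal H_1$ converge coefficientwise (as limits of the products over $-N\le n\le N$) to invertible operators; the operators $w_0(m^+n^-)$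 and $w_0(m^+n^-)-q$ are invertible; and for every $m\in\mathbb Z$ $$\mathcal T\big(w_0(m^+m^-)\big)=\frac{w_0(m^+(m-1)^-)-q\Delta(m^+(m-1)^-)}{w_0(m^+(m-1)^-)-q}\cdot\frac{w_0((m+1)^+m^-)-q\Delta((m+1)^+m^-)}{w_0((m+1)^+m^-)-q}\;w_0((m+1)^+(m-1)^-)^{-1},$$ $$\mathcal T^{-1}\big(w_0((m+1)^+m^-)\big)=w_0(m^+(m+1)^-)^{-1}\;\frac{w_0(m^+m^-)-q\Delta(m^+m^-)}{w_0(m^+m^-)-q}\cdot\frac{w_0((m+1)^+(m+1)^-)-q\Delta((m+1)^+(m+1)^-)}{w_0((m+1)^+(m+1)^-)-q}.$$ -/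

import Mathlib

open Filter Topology

noncomputable section

namespace QLattice

/-- Points of the lattice: `(n, true)` is `n⁺` and `(n, false)` is `n⁻`. -/
abbrev Site := ℤ × Bool

/-- Exponents of Laurent monomials in the variables `e^{±α_i}` (`i = 0, 1`) attached to all the
lattice points: the variable `(s, i)` is `e^{α_i}` at a point `s = n⁺` and `e^{-α_i}` at a point
`s = n⁻`. -/
abbrev Expo := (Site × Fin 2) →₀ ℤ

/-- The space on which all operators act: formal Laurent series in the variables of all lattice
points whose exponents are bounded below by some (finitely supported) exponent.  It contains the
restricted tensor product of the polynomial spaces `ℂ[e^{±α_0}, e^{±α_1}]`; it is completed so that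
the infinite products in the `R` matrices act, and the variables are inverted so that
the operators `w_0` have inverses. -/
def LaurentSpace : Submodule ℂ (Expo → ℂ) where
  carrier := {f | ∃ b : Expo, ∀ e, f e ≠ 0 → b ≤ e}
  zero_mem' := ⟨0, fun e h => absurd rfl h⟩
  add_mem' := by
    rintro f g ⟨b, hb⟩ ⟨b', hb'⟩
    refine ⟨b ⊓ b', fun e he => ?_⟩
    by_cases hf : f e = 0
    · have hg : g e ≠ 0 := fun hg => he (by simp [hf, hg])
      exact inf_le_right.trans (hb' e hg)
    · exact inf_le_left.trans (hb e hf)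
  smul_mem' := by
    rintro a f ⟨b, hb⟩
    exact ⟨b, fun e he => hb e fun hf => he (by simp [hf])⟩

/-- The algebra of operators. -/
abbrev Op := Module.End ℂ LaurentSpace

/-- Multiplication by the Laurent monomial with exponent `g`. -/
def mulMonomial (g : Expo) : Op where
  toFun f := ⟨fun e => f.1 (e - g), by
    obtain ⟨b, hb⟩ := f.2
    exact ⟨b + g, fun e he => le_sub_iff_add_le.mp (hb _ he)⟩⟩
  map_add' _ _ := rfl
  map_smul' _ _ := rfl

/-- The operator multiplying the monomial with exponent `e` by `φ e`. -/
def diagonal (φ : Expo → ℂ) : Op where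
  toFun f := ⟨fun e => φ e * f.1 e, by
    obtain ⟨b, hb⟩ := f.2
    exact ⟨b, fun e he => hb e fun h => he (by simp [h])⟩⟩
  map_add' f g := by ext e; exact mul_add _ _ _
  map_smul' a f := by ext e; exact mul_left_comm _ _ _

/-- Coefficientwise convergence of a sequence of operators. -/
def TendstoOp (A : ℕ → Op) (L : Op) : Prop :=
  ∀ (f : LaurentSpace) (e : Expo), Tendsto (fun N => (A N f).1 e) atTop (𝓝 ((L f).1 e))

open Classical in
/-- The coefficientwise limit of a sequence of operators (`0` if there is none). -/
def limOp (A : ℕ → Op) : Op :=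
  if h : ∃ L, TendstoOp A L then h.choose else 0

/-- `(W, Q)_∞ = ∏_{n ≥ 0} (1 - Q ^ n W)`. -/
def qPoch (Q : ℂ) (W : Op) : Op :=
  limOp fun N => ((List.range N).map fun n => 1 - Q ^ n • W).prod

/-- The parameter `q = e^η`; powers are `q ^ x = e^{η x}`. -/
def q (η : ℂ) : ℂ := Complex.exp η

/-- `+1` on the points `n⁺`, `-1` on the points `n⁻`. -/
def sgn (s : Site) : ℂ := if s.2 then 1 else -1

/-- `E_i` at the point `s`: multiplication by `-(q - q⁻¹) e^{±α_i}`. -/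
def E (η : ℂ) (s : Site) (i : Fin 2) : Op :=
  (-(q η - (q η)⁻¹)) • mulMonomial (Finsupp.single (s, i) 1)

/-- `Δ = E_0 E_1` at the point `s`. -/
def DeltaAt (η : ℂ) (s : Site) : Op := E η s 0 * E η s 1

/-- Eigenvalues of the derivation `h_1` at the point `s`: `α_1(h_1) = 2`, `α_0(h_1) = -2`. -/
def h1Val (s : Site) (e : Expo) : ℂ := sgn s * (2 * (e (s, 1) : ℂ) - 2 * (e (s, 0) : ℂ))

/-- Eigenvalues of `h_i` at the point `s`, where `h_0 + h_1` is the central charge `c s`. -/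
def hVal (c : Site → ℂ) (s : Site) (i : Fin 2) (e : Expo) : ℂ :=
  if i = 0 then c s - h1Val s e else h1Val s e

/-- Eigenvalues of the scaling derivation `d` at the point `s`: `α_0(d) = 1`, `α_1(d) = 0`. -/
def dVal (s : Site) (e : Expo) : ℂ := sgn s * (e (s, 0) : ℂ)

/-- The diagonal operator `q ^ φ`. -/
def qPow (η : ℂ) (φ : Expo → ℂ) : Op := diagonal fun e => Complex.exp (η * φ e)

/-- `k_i = q ^ {h_i}` at the point `s`. -/
def k (η : ℂ) (c : Site → ℂ) (s : Site) (i : Fin 2) : Op := qPow η (hVal c s i)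

/-- `k_i⁻¹` at the point `s`. -/
def kInv (η : ℂ) (c : Site → ℂ) (s : Site) (i : Fin 2) : Op := qPow η fun e => -hVal c s i e

/-- Eigenvalues of `½ h_1 ⊗ h_1 + c ⊗ d + d ⊗ c` at the points `m⁺`, `n⁻`. -/
def TVal (c : Site → ℂ) (m n : ℤ) (e : Expo) : ℂ :=
  1 / 2 * h1Val (m, true) e * h1Val (n, false) e + c (m, true) * dVal (n, false) e +
    dVal (m, true) e * c (n, false)

/-- The `R` matrix at the points `m⁺`, `n⁻`. -/
def R (η : ℂ) (c : Site → ℂ) (m n : ℤ) : Op :=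
  Ring.inverse (qPoch (q η ^ 2) (q η • (E η (m, true) 1 * E η (n, false) 1))) *
  Ring.inverse (qPoch (q η ^ 4) (q η ^ 2 • (DeltaAt η (m, true) * DeltaAt η (n, false)))) *
  Ring.inverse (qPoch (q η ^ 2) (q η • (E η (m, true) 0 * E η (n, false) 0))) *
  qPow η fun e => -TVal c m n e

/-- The finite product `∏_{n = -N}^{N} R` at the points `(n + r)⁺`, `n⁻`. -/
def HTrunc (η : ℂ) (c : Site → ℂ) (r : ℤ) (N : ℕ) : Op :=
  ((List.range (2 * N + 1)).map fun j : ℕ => R η c ((j : ℤ) - N + r) ((j : ℤ) - N)).prod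

/-- The infinite product of the `R` matrices at `(n + r)⁺`, `n⁻` over all `n`: this is `H_0` for
`r = 0` and `H_1` for `r = 1`. -/
def HProd (η : ℂ) (c : Site → ℂ) (r : ℤ) : Op := limOp (HTrunc η c r)

/-- `H = H_0 H_1`. -/
def H (η : ℂ) (c : Site → ℂ) : Op := HProd η c 0 * HProd η c 1

/-- The time evolution `O ↦ H⁻¹ O H`. -/
def evol (η : ℂ) (c : Site → ℂ) (O : Op) : Op := Ring.inverse (H η c) * O * H η c

/-- The inverse time evolution `O ↦ H O H⁻¹`. -/
def evolInv (η : ℂ) (c : Site → ℂ) (O : Op) : Op := H η c * O * Ring.inverse (H η c)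

/-- The dynamical variables `w_i(m⁺n⁻)`. -/
def w (η : ℂ) (c : Site → ℂ) (i : Fin 2) (m n : ℤ) : Op :=
  if m ≡ n [ZMOD 2] then E η (m, true) i * E η (n, false) i
  else (E η (m, true) i * kInv η c (m, true) i) * (k η c (n, false) i * E η (n, false) i)

/-- `Δ(m⁺n⁻)`, normalized so that `w_0(m⁺n⁻) w_1(m⁺n⁻) = Δ(m⁺n⁻)` for all `m` and `n`. -/
def Delta (η : ℂ) (c : Site → ℂ) (m n : ℤ) : Op :=
  if m ≡ n [ZMOD 2] then DeltaAt η (m, true) * DeltaAt η (n, false)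
  else Complex.exp (η * (c (n, false) - c (m, true))) •
    (DeltaAt η (m, true) * DeltaAt η (n, false))

/-- `(w_0(m⁺n⁻) - q Δ(m⁺n⁻)) / (w_0(m⁺n⁻) - q)`. -/
def ratio (η : ℂ) (c : Site → ℂ) (m n : ℤ) : Op :=
  (w η c 0 m n - q η • Delta η c m n) * Ring.inverse (w η c 0 m n - q η • 1)

end QLattice

end

/-! The operators are handled in a normal form: multiplication by a power series followed by a
diagonal operator `q ^ φ`. Factors of `HProd` with different `n` live at disjoint pairs of sites, so
their diagonal parts move to the right, and `HProd_eq` gives the infinite product of the `rSeries`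
times `qPow η (Phi c r)`.

Two exchange relations then carry the theorem. `HProd_mul_wTwisted`: the diagonal part of the
product exactly absorbs the factor `k_0⁻¹ ⊗ k_0`, so at `(n + r)⁺`, `n⁻` it turns the twisted
variable into the plain one (`HProd_mul_ratio` extends this to the ratios).
`wTwisted_mul_HProd_mul`: at a pair `m⁺`, `n⁻` not coupled by the product, the twist rescales
variables in just the two factors touching `m⁺` or `n⁻`. There each `q ^ 2`-Pochhammer symbol shifts
by one step, and the leftover linear factors are the two ratios, up to monomials and powers of `q`.

For `evol`, the first relation is applied to `H_0` and the second to `H_1`; for `evolInv` the roles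
are exchanged. -/

noncomputable section

namespace QLattice

open MvPowerSeries

/-! ### Multiplication by power series -/

/-- Formal power series in the variables of all lattice points. -/
abbrev Series := MvPowerSeries (Site × Fin 2) ℂ

/-- The exponent of a monomial of a power series, as an integral exponent. -/
def toExpo : ((Site × Fin 2) →₀ ℕ) →+ Expo := Finsupp.mapRange.addMonoidHom (Nat.castAddMonoidHom ℤ)

@[simp] theorem toExpo_apply (p : (Site × Fin 2) →₀ ℕ) (s : Site × Fin 2) :
    toExpo p s = (p s : ℤ) := rfl

theorem toExpo_nonneg (p : (Site × Fin 2) →₀ ℕ) : 0 ≤ toExpo p := fun s => by simp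

theorem toExpo_single (s : Site × Fin 2) (n : ℕ) :
    toExpo (Finsupp.single s n) = Finsupp.single s (n : ℤ) := by
  simp [toExpo]

theorem exists_eq_toExpo {e : Expo} (h : 0 ≤ e) : ∃ p, e = toExpo p :=
  ⟨e.mapRange Int.toNat rfl, by ext s; simpa using h s⟩

/-- The power series `X ^ (-b) f` of a Laurent series `f` with exponents at least `b`. -/
def shift (b : Expo) (f : Expo → ℂ) : Series := fun p => f (b + toExpo p)

theorem coeff_shift (b : Expo) (f : Expo → ℂ) (p : (Site × Fin 2) →₀ ℕ) :
    coeff p (shift b f) = f (b + toExpo p) := rfl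

theorem finite_support_mul {f : Expo → ℂ} {b : Expo} (hb : ∀ e, f e ≠ 0 → b ≤ e)
    (F : Series) (e : Expo) :
    (Function.support fun p => coeff p F * f (e - toExpo p)).Finite := by
  refine (Set.finite_Iic ((e - b).mapRange Int.toNat rfl)).subset fun p hp s => ?_
  have h := hb _ (right_ne_zero_of_mul hp) s
  simp at h ⊢
  omega

/-- The lower bound `b` kills every term with `¬ i ≤ p`, leaving a Cauchy product over the
antidiagonal of `p`. -/
theorem finsum_mul_eq_coeff {f : Expo → ℂ} {b : Expo} (hb : ∀ e, f e ≠ 0 → b ≤ e)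
    (F : Series) (p : (Site × Fin 2) →₀ ℕ) :
    ∑ᶠ i, coeff i F * f (b + toExpo p - toExpo i) = coeff p (F * shift b f) := by
  classical
  have key : ∀ i, coeff i F * f (b + toExpo p - toExpo i) ≠ 0 → i ≤ p := fun i hi s => by
    have h := hb _ (right_ne_zero_of_mul hi) s
    simp at h ⊢
    omega
  rw [coeff_mul, finsum_eq_sum_of_support_subset (s := (Finset.HasAntidiagonal.antidiagonal p).image Prod.fst)]
  · rw [Finset.sum_image]
    · refine Finset.sum_congr rfl fun x hx => ?_
      rw [Finset.HasAntidiagonal.mem_antidiagonal] at hx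
      rw [coeff_shift, ← hx, map_add]
      congr 2
      abel
    · intro x hx y hy hxy
      simp only [Finset.mem_coe, Finset.HasAntidiagonal.mem_antidiagonal] at hx hy
      refine Prod.ext hxy ?_
      rw [← hy, hxy] at hx
      exact add_left_cancel hx
  · intro i hi
    obtain ⟨j, hj⟩ := le_iff_exists_add.mp (key i hi)
    simp only [Finset.coe_image, Set.mem_image, Finset.mem_coe, Finset.HasAntidiagonal.mem_antidiagonal]
    exact ⟨(i, j), hj.symm, rfl⟩

theorem le_of_finsum_ne_zero {f : Expo → ℂ} {b : Expo} (hb : ∀ e, f e ≠ 0 → b ≤ e)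
    (F : Series) (e : Expo) (he : ∑ᶠ p, coeff p F * f (e - toExpo p) ≠ 0) : b ≤ e := by
  obtain ⟨p, hp⟩ := not_forall.mp (mt finsum_eq_zero_of_forall_eq_zero he)
  exact (hb _ (right_ne_zero_of_mul hp)).trans (sub_le_self _ (toExpo_nonneg p))

/-- Multiplication by a power series, as a linear map. -/
def mulSeriesFun (F : Series) : Op where
  toFun f := ⟨fun e => ∑ᶠ p, coeff p F * f.1 (e - toExpo p), by
    obtain ⟨b, hb⟩ := f.2
    exact ⟨b, le_of_finsum_ne_zero hb F⟩⟩
  map_add' f g := by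
    obtain ⟨b, hb⟩ := f.2
    obtain ⟨b', hb'⟩ := g.2
    ext e
    simp only [Submodule.coe_add, Pi.add_apply, mul_add]
    exact finsum_add_distrib (finite_support_mul hb F e) (finite_support_mul hb' F e)
  map_smul' a f := by
    ext e
    simp only [Submodule.coe_smul, Pi.smul_apply, smul_eq_mul, RingHom.id_apply, mul_left_comm _ a]
    exact (smul_finsum a _).symm

theorem mulSeriesFun_apply (F : Series) (f : LaurentSpace) (e : Expo) :
    (mulSeriesFun F f).1 e = ∑ᶠ p, coeff p F * f.1 (e - toExpo p) := rfl

theorem shift_mulSeriesFun {f : LaurentSpace} {b : Expo} (hb : ∀ e, f.1 e ≠ 0 → b ≤ e)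
    (F : Series) : shift b (mulSeriesFun F f).1 = F * shift b f.1 := by
  ext p
  exact finsum_mul_eq_coeff hb F p

/-- Moving a common lower bound to the origin reduces identities of Laurent series to the ring
`Series`; this is how `mulSeries` inherits its algebra structure. -/
theorem ext_of_shift {f g : LaurentSpace} {b : Expo} (hf : ∀ e, f.1 e ≠ 0 → b ≤ e)
    (hg : ∀ e, g.1 e ≠ 0 → b ≤ e) (h : shift b f.1 = shift b g.1) : f = g := by
  ext e
  by_cases he : b ≤ e
  · obtain ⟨p, hp⟩ := exists_eq_toExpo (sub_nonneg.mpr he)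
    have := congrArg (coeff p) h
    rwa [coeff_shift, coeff_shift, ← hp, add_sub_cancel] at this
  · rw [not_ne_iff.mp (mt (hf e) he), not_ne_iff.mp (mt (hg e) he)]

/-- Multiplication by a power series. -/
def mulSeries : Series →ₐ[ℂ] Op :=
  AlgHom.ofLinearMap
    { toFun := mulSeriesFun
      map_add' := fun F G => by
        refine LinearMap.ext fun f => Subtype.ext (funext fun e => ?_)
        obtain ⟨b, hb⟩ := f.2
        simp only [LinearMap.add_apply, Submodule.coe_add, Pi.add_apply, mulSeriesFun_apply,
          map_add, add_mul]
        exact finsum_add_distrib (finite_support_mul hb F e) (finite_support_mul hb G e)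
      map_smul' := fun a F => by
        refine LinearMap.ext fun f => Subtype.ext (funext fun e => ?_)
        simp only [LinearMap.smul_apply, Submodule.coe_smul, Pi.smul_apply, mulSeriesFun_apply,
          map_smul, smul_eq_mul, RingHom.id_apply, mul_assoc]
        exact (smul_finsum a _).symm }
    (by
      refine LinearMap.ext fun f => ?_
      obtain ⟨b, hb⟩ := f.2
      refine ext_of_shift (le_of_finsum_ne_zero hb _) hb ?_
      exact (shift_mulSeriesFun hb 1).trans (one_mul _))
    (fun F G => by
      refine LinearMap.ext fun f => ?_
      obtain ⟨b, hb⟩ := f.2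
      refine ext_of_shift (le_of_finsum_ne_zero hb _)
        (le_of_finsum_ne_zero (le_of_finsum_ne_zero hb _) _) ?_
      refine (shift_mulSeriesFun hb _).trans ?_
      refine Eq.trans ?_ (shift_mulSeriesFun (le_of_finsum_ne_zero hb _) _).symm
      rw [mul_assoc]
      exact congrArg _ (shift_mulSeriesFun hb G).symm)

theorem mulSeries_apply (F : Series) (f : LaurentSpace) (e : Expo) :
    (mulSeries F f).1 e = ∑ᶠ p, coeff p F * f.1 (e - toExpo p) := rfl

/-! ### Monomials, diagonal operators and their commutation -/

theorem op_ext {A B : Op} (h : ∀ f e, (A f).1 e = (B f).1 e) : A = B :=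
  LinearMap.ext fun f => Subtype.ext (funext (h f))

theorem mulSeries_X (s : Site × Fin 2) :
    mulSeries (X s) = mulMonomial (Finsupp.single s 1) := by
  classical
  refine op_ext fun f e => ?_
  rw [mulSeries_apply, finsum_eq_single _ (Finsupp.single s 1)]
  · simp [X, toExpo_single, mulMonomial]
  · intro p hp
    rw [X, coeff_monomial_ne hp, zero_mul]

theorem mulMonomial_add (g h : Expo) : mulMonomial (g + h) = mulMonomial g * mulMonomial h :=
  op_ext fun f e => by simp [mulMonomial, sub_sub]

theorem mulMonomial_zero : mulMonomial 0 = 1 := op_ext fun f e => by simp [mulMonomial]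

theorem isUnit_mulMonomial (g : Expo) : IsUnit (mulMonomial g) :=
  ⟨⟨mulMonomial g, mulMonomial (-g), by rw [← mulMonomial_add, add_neg_cancel, mulMonomial_zero],
    by rw [← mulMonomial_add, neg_add_cancel, mulMonomial_zero]⟩, rfl⟩

theorem qPow_add (η : ℂ) (φ ψ : Expo → ℂ) :
    qPow η (fun e => φ e + ψ e) = qPow η φ * qPow η ψ :=
  op_ext fun f e => by simp [qPow, diagonal, mul_add, Complex.exp_add, mul_assoc]

theorem qPow_const (η a : ℂ) : qPow η (fun _ => a) = Complex.exp (η * a) • (1 : Op) :=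
  op_ext fun f e => by simp [qPow, diagonal]

theorem qPow_mul_comm (η : ℂ) (φ ψ : Expo → ℂ) : qPow η φ * qPow η ψ = qPow η ψ * qPow η φ := by
  simp only [← qPow_add, add_comm]

theorem qPow_neg_mul (η : ℂ) (φ : Expo → ℂ) : qPow η (fun e => -φ e) * qPow η φ = 1 := by
  rw [← qPow_add]
  simp [qPow_const]

theorem isUnit_qPow (η : ℂ) (φ : Expo → ℂ) : IsUnit (qPow η φ) :=
  ⟨⟨qPow η φ, qPow η fun e => -φ e, by rw [qPow_mul_comm, qPow_neg_mul], qPow_neg_mul η φ⟩, rfl⟩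

theorem qPow_mul_mulMonomial (η : ℂ) (φ : Expo → ℂ) (g : Expo) :
    qPow η φ * mulMonomial g = mulMonomial g * qPow η fun e => φ (e + g) :=
  op_ext fun f e => by simp [qPow, diagonal, mulMonomial]

/-- When each variable changes the eigenvalue by a fixed factor, the change along a monomial is the
product of these factors, which is what `rescale` does to its coefficient. -/
theorem qPow_mul_mulSeries {η : ℂ} {ψ : Expo → ℂ} {t : Site × Fin 2 → ℂ}
    (h : ∀ e s, Complex.exp (η * ψ (e + Finsupp.single s 1)) = t s * Complex.exp (η * ψ e))
    (F : Series) : qPow η ψ * mulSeries F = mulSeries (rescale t F) * qPow η ψ := by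
  have key : ∀ p e, Complex.exp (η * ψ (e + toExpo p)) =
      (p.prod fun s n => t s ^ n) * Complex.exp (η * ψ e) := by
    intro p
    induction p using Finsupp.induction_linear with
    | zero => simp
    | add p p' hp hp' =>
      intro e
      rw [map_add, ← add_assoc, hp', hp, ← mul_assoc,
        Finsupp.prod_add_index' (by simp) (by intros; rw [pow_add]), mul_comm (Finsupp.prod p' _)]
    | single s n =>
      simp only [toExpo_single]
      induction n with
      | zero => simp
      | succ n ih =>
        intro e
        have hs : ∀ n, ((Finsupp.single s n).prod fun s n => t s ^ n) = t s ^ n :=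
          fun n => Finsupp.prod_single_index (pow_zero _)
        rw [Nat.cast_succ, Finsupp.single_add, ← add_assoc, h, ih, hs, hs, pow_succ]
        ring
  refine op_ext fun f e => ?_
  obtain ⟨b, hb⟩ := f.2
  change Complex.exp (η * ψ e) * (mulSeries F f).1 e = (mulSeries _ _).1 e
  rw [mulSeries_apply, mulSeries_apply, ← smul_eq_mul, smul_finsum]
  refine finsum_congr fun p => ?_
  have := key p (e - toExpo p)
  rw [sub_add_cancel] at this
  change _ = _ * (Complex.exp (η * ψ (e - toExpo p)) * f.1 (e - toExpo p))
  rw [this, coeff_rescale, smul_eq_mul]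
  ring

/-! ### Coefficientwise limits of operators -/

theorem TendstoOp.unique {A : ℕ → Op} {L L' : Op} (h : TendstoOp A L) (h' : TendstoOp A L') :
    L = L' := op_ext fun f e => tendsto_nhds_unique (h f e) (h' f e)

theorem TendstoOp.limOp_eq {A : ℕ → Op} {L : Op} (h : TendstoOp A L) : limOp A = L := by
  have hex : ∃ L, TendstoOp A L := ⟨L, h⟩
  rw [limOp, dif_pos hex]
  exact hex.choose_spec.unique h

open scoped MvPowerSeries.WithPiTopology

/-- Each coefficient of the image is a sum over a finite box depending only on `e` and the lower
bound of `f`, not on `N`, so the limit passes termwise. -/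
theorem tendstoOp_mulSeries_mul_qPow {F : ℕ → Series} {F' : Series} (hF : Tendsto F atTop (𝓝 F'))
    (η : ℂ) {φ : ℕ → Expo → ℂ} {φ' : Expo → ℂ}
    (hφ : ∀ e, Tendsto (fun N => φ N e) atTop (𝓝 (φ' e))) :
    TendstoOp (fun N => mulSeries (F N) * qPow η (φ N)) (mulSeries F' * qPow η φ') := by
  intro f e
  obtain ⟨b, hb⟩ := f.2
  have hs : ∀ (G : Series) (ψ : Expo → ℂ), ((mulSeries G * qPow η ψ) f).1 e =
      ∑ p ∈ Finset.Iic ((e - b).mapRange Int.toNat rfl),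
        coeff p G * (Complex.exp (η * ψ (e - toExpo p)) * f.1 (e - toExpo p)) := by
    intro G ψ
    change (mulSeries G _).1 e = _
    rw [mulSeries_apply]
    refine finsum_eq_sum_of_support_subset _ fun p hp => ?_
    rw [Finset.coe_Iic]
    intro s
    have h := hb _ (right_ne_zero_of_mul (right_ne_zero_of_mul hp)) s
    simp at h ⊢
    omega
  simp only [hs]
  refine tendsto_finsetSum _ fun p _ => ?_
  refine Tendsto.mul ((WithPiTopology.continuous_coeff ℂ p).tendsto _ |>.comp hF) ?_
  refine Tendsto.mul_const _ ?_
  exact (Complex.continuous_exp.tendsto _).comp ((hφ _).const_mul η)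

theorem tendstoOp_mulSeries {F : ℕ → Series} {F' : Series} (hF : Tendsto F atTop (𝓝 F')) :
    TendstoOp (fun N => mulSeries (F N)) (mulSeries F') := by
  simpa [qPow_const] using
    tendstoOp_mulSeries_mul_qPow hF 0 (φ := fun _ _ => 0) (φ' := fun _ => 0)
      fun _ => tendsto_const_nhds

theorem TendstoOp.commute_qPow {A : ℕ → Op} {L : Op} (h : TendstoOp A L) {η : ℂ} {φ : Expo → ℂ}
    (hA : ∀ N, Commute (qPow η φ) (A N)) : Commute (qPow η φ) L := by
  refine op_ext fun f e => tendsto_nhds_unique (?_ : Tendsto _ _ _) (h (qPow η φ f) e)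
  have h1 := (h f e).const_mul (Complex.exp (η * φ e))
  refine h1.congr fun N => ?_
  exact congrFun (congrArg Subtype.val (LinearMap.congr_fun (hA N) f)) e

/-! ### `q`-Pochhammer symbols of power series -/

/-- The truncated `q`-Pochhammer symbol `∏_{n < N} (1 - Q ^ n w)`. -/
def pochTrunc (Q : ℂ) (w : Series) (N : ℕ) : Series :=
  ((List.range N).map fun n => 1 - Q ^ n • w).prod

theorem pochTrunc_zero (Q : ℂ) (w : Series) : pochTrunc Q w 0 = 1 := rfl

theorem pochTrunc_succ (Q : ℂ) (w : Series) (N : ℕ) :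
    pochTrunc Q w (N + 1) = pochTrunc Q w N * (1 - Q ^ N • w) := by
  simp [pochTrunc, List.range_succ]

theorem pochTrunc_succ' (Q : ℂ) (w : Series) (N : ℕ) :
    pochTrunc Q w (N + 1) = (1 - w) * pochTrunc Q (Q • w) N := by
  simp [pochTrunc, List.range_succ_eq_map, Function.comp_def, pow_succ, smul_smul]

/-- Induction on `p`: since `w` has no constant term, the coefficient of `w * pochTrunc Q w N` at
`p` involves only truncation coefficients at smaller exponents. It therefore converges and is
bounded, and successive differences at `p` are `Q ^ N` times it, hence geometrically small. -/
theorem exists_tendsto_coeff_pochTrunc {Q : ℂ} (hQ : ‖Q‖ < 1) {w : Series}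
    (hw : constantCoeff w = 0) (p : (Site × Fin 2) →₀ ℕ) :
    ∃ l, Tendsto (fun N => coeff p (pochTrunc Q w N)) atTop (𝓝 l) := by
  classical
  induction p using WellFoundedLT.induction with
  | ind p ih =>
    have hb : ∃ l, Tendsto (fun N => coeff p (w * pochTrunc Q w N)) atTop (𝓝 l) := by
      have : ∀ x ∈ Finset.HasAntidiagonal.antidiagonal p, ∃ l,
          Tendsto (fun N => coeff x.1 w * coeff x.2 (pochTrunc Q w N)) atTop (𝓝 l) := by
        intro x hx
        rw [Finset.HasAntidiagonal.mem_antidiagonal] at hx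
        by_cases h0 : x.1 = 0
        · exact ⟨0, by simp [h0, hw]⟩
        · obtain ⟨l, hl⟩ := ih x.2 (by
            rw [← hx]
            exact lt_add_of_pos_left _ (pos_iff_ne_zero.mpr h0))
          exact ⟨_, hl.const_mul _⟩
      choose! l hl using this
      refine ⟨∑ x ∈ Finset.HasAntidiagonal.antidiagonal p, l x, ?_⟩
      simp only [coeff_mul]
      exact tendsto_finsetSum _ hl
    obtain ⟨l, hl⟩ := hb
    obtain ⟨C, hC⟩ := (Metric.isBounded_range_of_tendsto _ hl).exists_norm_le
    refine cauchySeq_tendsto_of_complete (cauchySeq_of_le_geometric ‖Q‖ C hQ fun N => ?_)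
    have : coeff p (pochTrunc Q w N) - coeff p (pochTrunc Q w (N + 1)) =
        Q ^ N * coeff p (w * pochTrunc Q w N) := by
      rw [pochTrunc_succ, mul_sub, mul_one, map_sub, sub_sub_cancel, mul_smul_comm, map_smul,
        smul_eq_mul, mul_comm w]
    rw [dist_eq_norm, this, norm_mul, norm_pow, mul_comm]
    exact mul_le_mul_of_nonneg_right (hC _ ⟨N, rfl⟩) (by positivity)

/-- The `q`-Pochhammer symbol `∏_{n ≥ 0} (1 - Q ^ n w)`. -/
def poch (Q : ℂ) (w : Series) : Series := limUnder atTop (pochTrunc Q w)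

theorem tendsto_pochTrunc {Q : ℂ} (hQ : ‖Q‖ < 1) {w : Series}
    (hw : constantCoeff w = 0) : Tendsto (pochTrunc Q w)
    atTop (𝓝 (poch Q w)) := by
  refine tendsto_nhds_limUnder ?_
  choose l hl using exists_tendsto_coeff_pochTrunc hQ hw
  exact ⟨l, (WithPiTopology.tendsto_iff_coeff_tendsto ..).mpr hl⟩

theorem poch_eq {Q : ℂ} (hQ : ‖Q‖ < 1) {w : Series}
    (hw : constantCoeff w = 0) : poch Q w = (1 - w) * poch Q (Q • w) := by
  refine tendsto_nhds_unique ((tendsto_pochTrunc hQ hw).comp (tendsto_add_atTop_nat 1)) ?_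
  refine ((tendsto_pochTrunc hQ (w := Q • w) (by simp [hw])).const_mul (1 - w)).congr fun N => ?_
  exact (pochTrunc_succ' Q w N).symm

theorem rescale_smul (t : Site × Fin 2 → ℂ) (a : ℂ) (F : Series) :
    rescale t (a • F) = a • rescale t F := by
  ext p
  simp only [coeff_rescale, map_smul, smul_eq_mul, mul_left_comm]

theorem rescale_poch {Q : ℂ} (hQ : ‖Q‖ < 1) {w : Series}
    (hw : constantCoeff w = 0)
    (t : Site × Fin 2 → ℂ) :
    rescale t (poch Q w) = poch Q (rescale t w) := by
  have hc : constantCoeff (rescale t w) = 0 := by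
    rw [← coeff_zero_eq_constantCoeff_apply] at hw ⊢
    rw [coeff_rescale, hw, mul_zero]
  refine tendsto_nhds_unique ?_ (tendsto_pochTrunc hQ hc)
  have : Tendsto (fun N => rescale t (pochTrunc Q w N)) atTop (𝓝 (rescale t (poch Q w))) := by
    rw [WithPiTopology.tendsto_iff_coeff_tendsto]
    intro p
    simp only [coeff_rescale]
    exact ((WithPiTopology.tendsto_iff_coeff_tendsto ..).mp (tendsto_pochTrunc hQ hw) p).const_mul _
  refine this.congr fun N => ?_
  simp [pochTrunc, map_list_prod, Function.comp_def, rescale_smul]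

theorem qPoch_mulSeries {Q : ℂ} (hQ : ‖Q‖ < 1) {w : Series}
    (hw : constantCoeff w = 0) : qPoch Q (mulSeries w) = mulSeries (poch Q w) := by
  refine TendstoOp.limOp_eq ?_
  convert tendstoOp_mulSeries (tendsto_pochTrunc hQ hw) using 2 with N
  simp [pochTrunc, map_list_prod, Function.comp_def]

/-! ### Congruences modulo `vanishBelow` and infinite products -/

/-- The power series all of whose coefficients at exponents at most `p` vanish. -/
def vanishBelow (p : (Site × Fin 2) →₀ ℕ) : Ideal Series where
  carrier := {F | ∀ i ≤ p, coeff i F = 0}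
  zero_mem' _ _ := map_zero _
  add_mem' hF hG i hi := by rw [map_add, hF i hi, hG i hi, add_zero]
  smul_mem' A F hF i hi := by
    classical
    rw [smul_eq_mul, coeff_mul]
    refine Finset.sum_eq_zero fun x hx => ?_
    rw [Finset.HasAntidiagonal.mem_antidiagonal] at hx
    rw [hF x.2 (le_trans (le_of_le_of_eq le_add_self hx) hi), mul_zero]

theorem pochTrunc_sub_one_mem {Q : ℂ} {w : Series} {I : Ideal Series} (h : w ∈ I) (N : ℕ) :
    pochTrunc Q w N - 1 ∈ I := by
  induction N with
  | zero => simp [pochTrunc_zero]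
  | succ N ih =>
    have h' : pochTrunc Q w N * (Q ^ N • w) ∈ I :=
      I.mul_mem_left _ (by rw [smul_eq_C_mul]; exact I.mul_mem_left _ h)
    rw [pochTrunc_succ, mul_sub, mul_one, sub_right_comm]
    exact I.sub_mem ih h'

theorem poch_sub_one_mem {Q : ℂ} (hQ : ‖Q‖ < 1) {w : Series} (hw : constantCoeff w = 0)
    {p : (Site × Fin 2) →₀ ℕ} (h : w ∈ vanishBelow p) : poch Q w - 1 ∈ vanishBelow p := by
  intro i hi
  have h1 := (WithPiTopology.continuous_coeff ℂ i).tendsto _ |>.comp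
    ((tendsto_pochTrunc hQ hw).sub_const 1)
  refine tendsto_nhds_unique h1 (tendsto_const_nhds.congr fun N => ?_)
  exact (pochTrunc_sub_one_mem h N i hi).symm

theorem constantCoeff_poch {Q : ℂ} (hQ : ‖Q‖ < 1) {w : Series} (hw : constantCoeff w = 0) :
    constantCoeff (poch Q w) = 1 := by
  have h : w ∈ vanishBelow 0 := fun i hi => by
    rw [nonpos_iff_eq_zero.mp hi, coeff_zero_eq_constantCoeff_apply, hw]
  have := poch_sub_one_mem hQ hw h 0 le_rfl
  simpa [sub_eq_zero] using this

theorem inv_sub_one_mem {F : Series} (hF : constantCoeff F ≠ 0) {I : Ideal Series}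
    (h : F - 1 ∈ I) : F⁻¹ - 1 ∈ I := by
  have := I.mul_mem_left (-F⁻¹) h
  rwa [mul_sub, neg_mul, MvPowerSeries.inv_mul_cancel _ hF, mul_one, sub_neg_eq_add, add_comm,
    ← sub_eq_add_neg] at this

theorem mul_sub_one_mem {F G : Series} {I : Ideal Series} (hF : F - 1 ∈ I) (hG : G - 1 ∈ I) :
    F * G - 1 ∈ I := by
  have : F * G - 1 = F * (G - 1) + (F - 1) := by ring
  rw [this]
  exact I.add_mem (I.mul_mem_left _ hG) hF

theorem isUnit_mulSeries {F : Series} (hF : constantCoeff F ≠ 0) : IsUnit (mulSeries F) :=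
  (IsUnit.of_mul_eq_one _ (MvPowerSeries.mul_inv_cancel F hF)).map mulSeries

theorem inverse_mulSeries {F : Series} (hF : constantCoeff F ≠ 0) :
    Ring.inverse (mulSeries F) = mulSeries F⁻¹ := by
  rw [← mul_one (Ring.inverse _), Ring.inverse_mul_eq_iff_eq_mul _ _ _ (isUnit_mulSeries hF),
    ← map_mul, MvPowerSeries.mul_inv_cancel F hF, map_one]

/-- The factors outside `s p` are `1` modulo `vanishBelow p`, so the coefficient at `p` of the
finite products is constant once they contain `s p`. -/
theorem multipliable_of_sub_one_mem {ι : Type*} {F : ι → Series}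
    (h : ∀ p, ∃ s : Finset ι, ∀ n ∉ s, F n - 1 ∈ vanishBelow p) : Multipliable F := by
  classical
  choose s hs using h
  let L : Series := fun p => coeff p (∏ n ∈ s p, F n)
  refine ⟨L, (WithPiTopology.tendsto_iff_coeff_tendsto ..).mpr fun p => ?_⟩
  refine tendsto_const_nhds.congr' ?_
  filter_upwards [eventually_ge_atTop (s p)] with u hu
  have hm : ∏ n ∈ u, F n - ∏ n ∈ s p, F n ∈ vanishBelow p := by
    rw [← Ideal.Quotient.eq, map_prod, map_prod]
    refine (Finset.prod_subset hu fun n _ hn => ?_).symm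
    rw [← map_one (Ideal.Quotient.mk _), Ideal.Quotient.eq]
    exact hs p n hn
  have := hm p le_rfl
  rw [map_sub, sub_eq_zero] at this
  exact this.symm

theorem rescale_tprod {ι : Type*} {F : ι → Series} (hF : Multipliable F) (t : Site × Fin 2 → ℂ) :
    HasProd (fun n => rescale t (F n)) (rescale t (∏' n, F n)) := by
  have h := hF.hasProd
  simp only [HasProd, WithPiTopology.tendsto_iff_coeff_tendsto, ← map_prod, coeff_rescale] at h ⊢
  exact fun p => (h p).const_mul _

theorem constantCoeff_tprod {ι : Type*} {F : ι → Series} (hF : Multipliable F)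
    (h : ∀ n, constantCoeff (F n) = 1) : constantCoeff (∏' n, F n) = 1 := by
  have := (WithPiTopology.continuous_constantCoeff ℂ).tendsto _ |>.comp hF.hasProd
  refine tendsto_nhds_unique this (tendsto_const_nhds.congr fun s => ?_)
  simp [map_prod, h]

/-! ### Normal form of the `R` matrices and of their infinite products -/

theorem q_ne_zero (η : ℂ) : q η ≠ 0 := Complex.exp_ne_zero η

theorem norm_q_pow_lt_one {η : ℂ} (hη : η.re < 0) {n : ℕ} (hn : n ≠ 0) : ‖q η ^ n‖ < 1 := by
  rw [norm_pow, q, Complex.norm_exp]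
  exact pow_lt_one₀ (Real.exp_nonneg _) (Real.exp_lt_one_iff.mpr hη) hn

theorem q_sub_inv_ne_zero {η : ℂ} (hη : η.re < 0) : -(q η - (q η)⁻¹) ≠ 0 := by
  intro h
  have h1 : q η ^ 2 = 1 := by
    have h0 := q_ne_zero η
    field_simp at h
    linear_combination -h
  have := norm_q_pow_lt_one hη two_ne_zero
  rw [h1] at this
  simp at this

/-- The power series `E_i` at the point `s`. -/
def eSeries (η : ℂ) (s : Site) (i : Fin 2) : Series := (-(q η - (q η)⁻¹)) • X (s, i)

/-- The power series `E_i ⊗ E_i` at the points `m⁺`, `n⁻`. -/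
def wSeries (η : ℂ) (i : Fin 2) (m n : ℤ) : Series :=
  eSeries η (m, true) i * eSeries η (n, false) i

/-- The power series `Δ ⊗ Δ` at the points `m⁺`, `n⁻`. -/
def deltaSeries (η : ℂ) (m n : ℤ) : Series := wSeries η 0 m n * wSeries η 1 m n

/-- The power series factor of the `R` matrix at the points `m⁺`, `n⁻`. -/
def rSeries (η : ℂ) (m n : ℤ) : Series :=
  (poch (q η ^ 2) (q η • wSeries η 1 m n))⁻¹ *
    (poch (q η ^ 4) (q η ^ 2 • deltaSeries η m n))⁻¹ *
    (poch (q η ^ 2) (q η • wSeries η 0 m n))⁻¹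

theorem E_eq (η : ℂ) (s : Site) (i : Fin 2) : E η s i = mulSeries (eSeries η s i) := by
  rw [eSeries, map_smul, mulSeries_X, E]

theorem E_mul_E (η : ℂ) (i : Fin 2) (m n : ℤ) :
    E η (m, true) i * E η (n, false) i = mulSeries (wSeries η i m n) := by
  rw [E_eq, E_eq, ← map_mul, wSeries]

theorem DeltaAt_mul_DeltaAt (η : ℂ) (m n : ℤ) :
    DeltaAt η (m, true) * DeltaAt η (n, false) = mulSeries (deltaSeries η m n) := by
  simp only [DeltaAt, E_eq, ← map_mul, deltaSeries, wSeries]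
  congr 1
  ring

theorem constantCoeff_wSeries (η : ℂ) (i : Fin 2) (m n : ℤ) :
    constantCoeff (wSeries η i m n) = 0 := by
  simp [wSeries, eSeries]

theorem constantCoeff_smul_wSeries (η : ℂ) (i : Fin 2) (m n : ℤ) (a : ℂ) :
    constantCoeff (a • wSeries η i m n) = 0 := by
  simp [constantCoeff_wSeries]

theorem constantCoeff_smul_deltaSeries (η : ℂ) (m n : ℤ) (a : ℂ) :
    constantCoeff (a • deltaSeries η m n) = 0 := by
  simp [deltaSeries, constantCoeff_wSeries]

theorem wSeries_mem_vanishBelow (η : ℂ) {i : Fin 2} (m : ℤ) {n : ℤ} {p : (Site × Fin 2) →₀ ℕ}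
    (h : p ((n, false), i) = 0) : wSeries η i m n ∈ vanishBelow p := by
  classical
  refine Ideal.mul_mem_left _ _ ?_
  rw [eSeries, smul_eq_C_mul]
  refine Ideal.mul_mem_left _ _ fun j hj => ?_
  rw [coeff_X, if_neg]
  rintro rfl
  have := hj ((n, false), i)
  simp [h] at this

theorem smul_mem_ideal {I : Ideal Series} {F : Series} (a : ℂ) (h : F ∈ I) : a • F ∈ I := by
  rw [smul_eq_C_mul]
  exact I.mul_mem_left _ h

section

variable {η : ℂ}

theorem constantCoeff_poch_wSeries (hη : η.re < 0) (i : Fin 2) (m n : ℤ) :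
    constantCoeff (poch (q η ^ 2) (q η • wSeries η i m n)) = 1 :=
  constantCoeff_poch (norm_q_pow_lt_one hη two_ne_zero) (constantCoeff_smul_wSeries ..)

theorem constantCoeff_poch_deltaSeries (hη : η.re < 0) (m n : ℤ) :
    constantCoeff (poch (q η ^ 4) (q η ^ 2 • deltaSeries η m n)) = 1 :=
  constantCoeff_poch (norm_q_pow_lt_one hη four_ne_zero) (constantCoeff_smul_deltaSeries ..)

theorem constantCoeff_rSeries (hη : η.re < 0) (m n : ℤ) : constantCoeff (rSeries η m n) = 1 := by
  simp [rSeries, constantCoeff_poch_wSeries hη, constantCoeff_poch_deltaSeries hη]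

theorem R_eq (hη : η.re < 0) (c : Site → ℂ) (m n : ℤ) :
    R η c m n = mulSeries (rSeries η m n) * qPow η fun e => -TVal c m n e := by
  have h2 := norm_q_pow_lt_one hη two_ne_zero
  have h4 := norm_q_pow_lt_one hη four_ne_zero
  rw [R, E_mul_E, E_mul_E, DeltaAt_mul_DeltaAt, ← map_smul, ← map_smul, ← map_smul,
    qPoch_mulSeries h2 (constantCoeff_smul_wSeries ..),
    qPoch_mulSeries h4 (constantCoeff_smul_deltaSeries ..),
    qPoch_mulSeries h2 (constantCoeff_smul_wSeries ..),
    inverse_mulSeries (by rw [constantCoeff_poch_wSeries hη]; exact one_ne_zero),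
    inverse_mulSeries (by rw [constantCoeff_poch_deltaSeries hη]; exact one_ne_zero),
    inverse_mulSeries (by rw [constantCoeff_poch_wSeries hη]; exact one_ne_zero),
    ← map_mul, ← map_mul, rSeries]

/-- Every nonconstant monomial here contains a variable of `n⁻`, which does not occur in `p`. As `p`
meets finitely many sites, this gives convergence of the product. -/
theorem rSeries_sub_one_mem (hη : η.re < 0) (m : ℤ) {n : ℤ} {p : (Site × Fin 2) →₀ ℕ}
    (h : ∀ i, p ((n, false), i) = 0) : rSeries η m n - 1 ∈ vanishBelow p := by
  have h2 := norm_q_pow_lt_one hη two_ne_zero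
  have h4 := norm_q_pow_lt_one hη four_ne_zero
  have hw := fun i => wSeries_mem_vanishBelow η m (h i)
  refine mul_sub_one_mem (mul_sub_one_mem ?_ ?_) ?_
  · refine inv_sub_one_mem (by rw [constantCoeff_poch_wSeries hη]; exact one_ne_zero) ?_
    exact poch_sub_one_mem h2 (constantCoeff_smul_wSeries ..) (smul_mem_ideal _ (hw 1))
  · refine inv_sub_one_mem (by rw [constantCoeff_poch_deltaSeries hη]; exact one_ne_zero) ?_
    exact poch_sub_one_mem h4 (constantCoeff_smul_deltaSeries ..)
      (smul_mem_ideal _ (Ideal.mul_mem_left _ _ (hw 1)))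
  · refine inv_sub_one_mem (by rw [constantCoeff_poch_wSeries hη]; exact one_ne_zero) ?_
    exact poch_sub_one_mem h2 (constantCoeff_smul_wSeries ..) (smul_mem_ideal _ (hw 0))

theorem multipliable_rSeries (hη : η.re < 0) (r : ℤ) :
    Multipliable fun n => rSeries η (n + r) n := by
  refine multipliable_of_sub_one_mem fun p => ⟨p.support.image fun s => s.1.1, fun n hn => ?_⟩
  refine rSeries_sub_one_mem hη _ fun i => ?_
  by_contra h
  exact hn (Finset.mem_image.mpr ⟨((n, false), i), Finsupp.mem_support_iff.mpr h, rfl⟩)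

theorem commute_qPow_inv {φ : Expo → ℂ} {F : Series} (hF : constantCoeff F ≠ 0)
    (h : Commute (qPow η φ) (mulSeries F)) : Commute (qPow η φ) (mulSeries F⁻¹) := by
  have h1 : mulSeries F * mulSeries F⁻¹ = 1 := by
    rw [← map_mul, MvPowerSeries.mul_inv_cancel F hF, map_one]
  have h2 : mulSeries F⁻¹ * mulSeries F = 1 := by
    rw [← map_mul, MvPowerSeries.inv_mul_cancel F hF, map_one]
  exact Commute.units_inv_right (u := ⟨mulSeries F, mulSeries F⁻¹, h1, h2⟩) h

theorem commute_qPow_poch {φ : Expo → ℂ} {Q : ℂ} (hQ : ‖Q‖ < 1) {w : Series}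
    (hw : constantCoeff w = 0) (h : Commute (qPow η φ) (mulSeries w)) :
    Commute (qPow η φ) (mulSeries (poch Q w)) := by
  refine (tendstoOp_mulSeries (tendsto_pochTrunc hQ hw)).commute_qPow fun N => ?_
  induction N with
  | zero => simp [pochTrunc_zero]
  | succ N ih =>
    rw [pochTrunc_succ, map_mul, sub_eq_add_neg, ← neg_smul, map_add, map_smul, map_one]
    exact ih.mul_right ((Commute.one_right _).add_right (h.smul_right _))

theorem commute_qPow_E {φ : Expo → ℂ} {s : Site} {i : Fin 2}
    (h : ∀ e, φ (e + Finsupp.single (s, i) 1) = φ e) : Commute (qPow η φ) (E η s i) := by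
  rw [E]
  refine Commute.smul_right ?_ _
  rw [Commute, SemiconjBy, qPow_mul_mulMonomial]
  simp only [h]

theorem commute_qPow_mulSeries_rSeries (hη : η.re < 0) {φ : Expo → ℂ} {m n : ℤ}
    (hm : ∀ i e, φ (e + Finsupp.single ((m, true), i) 1) = φ e)
    (hn : ∀ i e, φ (e + Finsupp.single ((n, false), i) 1) = φ e) :
    Commute (qPow η φ) (mulSeries (rSeries η m n)) := by
  have h2 := norm_q_pow_lt_one hη two_ne_zero
  have h4 := norm_q_pow_lt_one hη four_ne_zero
  have hw : ∀ i, Commute (qPow η φ) (mulSeries (wSeries η i m n)) := fun i => by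
    rw [← E_mul_E]
    exact (commute_qPow_E (hm i)).mul_right (commute_qPow_E (hn i))
  have hw' : ∀ i, Commute (qPow η φ) (mulSeries (poch (q η ^ 2) (q η • wSeries η i m n))⁻¹) :=
    fun i => by
      refine commute_qPow_inv (by rw [constantCoeff_poch_wSeries hη]; exact one_ne_zero) ?_
      refine commute_qPow_poch h2 (constantCoeff_smul_wSeries ..) ?_
      rw [map_smul]
      exact (hw i).smul_right _
  rw [rSeries, map_mul, map_mul]
  refine ((hw' 1).mul_right ?_).mul_right (hw' 0)
  refine commute_qPow_inv (by rw [constantCoeff_poch_deltaSeries hη]; exact one_ne_zero) ?_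
  refine commute_qPow_poch h4 (constantCoeff_smul_deltaSeries ..) ?_
  rw [map_smul, deltaSeries, map_mul]
  exact ((hw 0).mul_right (hw 1)).smul_right _

theorem TVal_congr {c : Site → ℂ} {m n : ℤ} {e e' : Expo}
    (hm : ∀ i, e ((m, true), i) = e' ((m, true), i))
    (hn : ∀ i, e ((n, false), i) = e' ((n, false), i)) : TVal c m n e = TVal c m n e' := by
  simp [TVal, h1Val, dVal, hm, hn]

/-- For distinct `n` the pairs `(n + r)⁺`, `n⁻` are disjoint, so the diagonal part of one factor
commutes with the series of the others. Repeated indices would break this, whence `Nodup`. -/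
theorem prod_map_R (hη : η.re < 0) (c : Site → ℂ) (r : ℤ) (l : List ℤ) (hl : l.Nodup) :
    (l.map fun n => R η c (n + r) n).prod =
      mulSeries (l.map fun n => rSeries η (n + r) n).prod *
        qPow η fun e => (l.map fun n => -TVal c (n + r) n e).sum := by
  induction l with
  | nil => simp [qPow_const]
  | cons n l ih =>
    rw [List.nodup_cons] at hl
    have hc : Commute (qPow η fun e => -TVal c (n + r) n e)
        (mulSeries (l.map fun n => rSeries η (n + r) n).prod) := by
      rw [map_list_prod, List.map_map]
      refine Commute.list_prod_right _ _ fun x hx => ?_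
      obtain ⟨j, hj, rfl⟩ := List.mem_map.mp hx
      have hne : n ≠ j := by rintro rfl; exact hl.1 hj
      refine commute_qPow_mulSeries_rSeries hη ?_ ?_ <;> intro i e <;>
        refine congrArg _ (TVal_congr ?_ ?_) <;> intro i' <;>
        simp [hne.symm]
    simp only [List.map_cons, List.prod_cons, List.sum_cons]
    rw [ih hl.2, R_eq hη, mul_assoc, ← mul_assoc (qPow _ _), hc.eq, map_mul, qPow_add]
    simp only [mul_assoc]

/-- The exponent of the diagonal factor of the infinite product of the `R` matrices. -/
def Phi (c : Site → ℂ) (r : ℤ) (e : Expo) : ℂ := ∑' n : ℤ, -TVal c (n + r) n e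

theorem summable_TVal (c : Site → ℂ) (r : ℤ) (e : Expo) :
    Summable fun n : ℤ => -TVal c (n + r) n e := by
  refine summable_of_ne_finset_zero (s := (e.support.image fun s => s.1.1) ∪
    e.support.image fun s => s.1.1 - r) fun n hn => ?_
  rw [Finset.mem_union, not_or] at hn
  rw [TVal_congr (e' := 0)]
  · simp [TVal, h1Val, dVal]
  · intro i
    by_contra h
    exact hn.2 (Finset.mem_image.mpr ⟨_, Finsupp.mem_support_iff.mpr h, by simp⟩)
  · intro i
    by_contra h
    exact hn.1 (Finset.mem_image.mpr ⟨_, Finsupp.mem_support_iff.mpr h, rfl⟩)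

theorem HTrunc_eq (hη : η.re < 0) (c : Site → ℂ) (r : ℤ) (N : ℕ) :
    HTrunc η c r N = mulSeries (∏ n ∈ Finset.Icc (-(N : ℤ)) N, rSeries η (n + r) n) *
      qPow η fun e => ∑ n ∈ Finset.Icc (-(N : ℤ)) N, -TVal c (n + r) n e := by
  set l : List ℤ := (List.range (2 * N + 1)).map fun j : ℕ => (j : ℤ) - N with hl
  have hnd : l.Nodup := List.nodup_range.map fun i j hij => by simpa using hij
  have hs : Finset.Icc (-(N : ℤ)) N = l.toFinset := by
    ext n
    simp only [hl, Finset.mem_Icc, List.mem_toFinset, List.mem_map, List.mem_range]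
    constructor
    · intro h
      exact ⟨(n + N).toNat, by omega, by omega⟩
    · rintro ⟨j, hj, rfl⟩
      omega
  have hR : HTrunc η c r N = (l.map fun n => R η c (n + r) n).prod := by
    rw [HTrunc, hl, List.map_map]
    rfl
  rw [hR, prod_map_R hη c r l hnd, hs, List.prod_toFinset _ hnd]
  simp only [List.sum_toFinset _ hnd]

theorem tendstoOp_HTrunc (hη : η.re < 0) (c : Site → ℂ) (r : ℤ) :
    TendstoOp (HTrunc η c r)
      (mulSeries (∏' n : ℤ, rSeries η (n + r) n) * qPow η (Phi c r)) := by
  have h := tendstoOp_mulSeries_mul_qPow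
    ((multipliable_rSeries hη r).hasProd.comp Finset.tendsto_Icc_neg) η
    fun e => (summable_TVal c r e).hasSum.comp Finset.tendsto_Icc_neg
  have he : HTrunc η c r = _ := funext fun N => HTrunc_eq hη c r N
  rw [he]
  exact h

theorem HProd_eq (hη : η.re < 0) (c : Site → ℂ) (r : ℤ) :
    HProd η c r = mulSeries (∏' n : ℤ, rSeries η (n + r) n) * qPow η (Phi c r) :=
  (tendstoOp_HTrunc hη c r).limOp_eq

theorem isUnit_HProd (hη : η.re < 0) (c : Site → ℂ) (r : ℤ) : IsUnit (HProd η c r) := by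
  rw [HProd_eq hη]
  refine (isUnit_mulSeries ?_).mul (isUnit_qPow _ _)
  rw [constantCoeff_tprod (multipliable_rSeries hη r) fun n => constantCoeff_rSeries hη _ _]
  exact one_ne_zero

theorem isUnit_R (hη : η.re < 0) (c : Site → ℂ) (m n : ℤ) : IsUnit (R η c m n) := by
  rw [R_eq hη]
  refine (isUnit_mulSeries ?_).mul (isUnit_qPow _ _)
  rw [constantCoeff_rSeries hη]
  exact one_ne_zero

end

/-! ### Plain and twisted variables against diagonal operators -/

/-- The exponent of `e^{α_i} ⊗ e^{-α_i}` at the points `m⁺`, `n⁻`. -/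
def wExpo (i : Fin 2) (m n : ℤ) : Expo :=
  Finsupp.single ((m, true), i) 1 + Finsupp.single ((n, false), i) 1

theorem mulSeries_wSeries (η : ℂ) (i : Fin 2) (m n : ℤ) :
    mulSeries (wSeries η i m n) = (-(q η - (q η)⁻¹)) ^ 2 • mulMonomial (wExpo i m n) := by
  rw [wSeries, eSeries, eSeries, smul_mul_smul_comm, map_smul, map_mul, mulSeries_X, mulSeries_X,
    wExpo, mulMonomial_add, sq]

theorem mulSeries_deltaSeries (η : ℂ) (m n : ℤ) :
    mulSeries (deltaSeries η m n) =
      (-(q η - (q η)⁻¹)) ^ 4 • mulMonomial (wExpo 0 m n + wExpo 1 m n) := by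
  rw [deltaSeries, map_mul, mulSeries_wSeries, mulSeries_wSeries, smul_mul_smul_comm, ← pow_add,
    mulMonomial_add]

theorem isUnit_mulSeries_wSeries {η : ℂ} (hη : η.re < 0) (i : Fin 2) (m n : ℤ) :
    IsUnit (mulSeries (wSeries η i m n)) := by
  rw [mulSeries_wSeries, ← Units.smul_mk0 (pow_ne_zero 2 (q_sub_inv_ne_zero hη))]
  exact (isUnit_mulMonomial _).smul _

/-- The operator `(E_0 k_0⁻¹) ⊗ (k_0 E_0)` at the points `m⁺`, `n⁻`. -/
def wTwisted (η : ℂ) (c : Site → ℂ) (m n : ℤ) : Op :=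
  (E η (m, true) 0 * kInv η c (m, true) 0) * (k η c (n, false) 0 * E η (n, false) 0)

theorem qPow_congr (η : ℂ) {φ ψ : Expo → ℂ} (h : ∀ e, φ e = ψ e) : qPow η φ = qPow η ψ :=
  congrArg _ (funext h)

/-- The `-2` comes from moving `k_0` to the right of `E_0` at `n⁻`. -/
theorem wTwisted_eq (η : ℂ) (c : Site → ℂ) (m n : ℤ) :
    wTwisted η c m n = mulSeries (wSeries η 0 m n) *
      qPow η fun e => -hVal c (m, true) 0 e + hVal c (n, false) 0 e - 2 := by
  have h : qPow η (fun e => -hVal c (m, true) 0 e) *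
      (qPow η (hVal c (n, false) 0) * E η (n, false) 0) =
      E η (n, false) 0 * qPow η fun e => -hVal c (m, true) 0 e + hVal c (n, false) 0 e - 2 := by
    rw [← mul_assoc, ← qPow_add, E, mul_smul_comm, qPow_mul_mulMonomial, smul_mul_assoc]
    congr 2
    refine qPow_congr η fun e => ?_
    simp [hVal, h1Val, sgn]
    ring
  rw [wTwisted, kInv, k, mul_assoc, h, ← E_mul_E, mul_assoc]

/-- The hypothesis says that passing the monomial adds to `φ` the negative of the exponent in
`wTwisted_eq`, so the twist cancels. -/
theorem qPow_mul_wTwisted {η : ℂ} {c : Site → ℂ} {m n : ℤ} {φ : Expo → ℂ}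
    (h : ∀ e, φ (e + wExpo 0 m n) = φ e + hVal c (m, true) 0 e - hVal c (n, false) 0 e + 2) :
    qPow η φ * wTwisted η c m n = mulSeries (wSeries η 0 m n) * qPow η φ := by
  rw [wTwisted_eq, mulSeries_wSeries, smul_mul_assoc, smul_mul_assoc, mul_smul_comm, ← mul_assoc,
    qPow_mul_mulMonomial, mul_assoc, ← qPow_add]
  congr 2
  refine qPow_congr η fun e => ?_
  rw [h]
  ring

theorem qPow_mul_smul_deltaSeries {η : ℂ} {c : Site → ℂ} {m n : ℤ} {φ : Expo → ℂ}
    (h : ∀ e, φ (e + (wExpo 0 m n + wExpo 1 m n)) = φ e + c (m, true) - c (n, false)) :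
    qPow η φ * (Complex.exp (η * (c (n, false) - c (m, true))) • mulSeries (deltaSeries η m n)) =
      mulSeries (deltaSeries η m n) * qPow η φ := by
  rw [← mul_one (mulSeries _), ← mul_smul_comm, ← qPow_const, mulSeries_deltaSeries,
    smul_mul_assoc, mul_smul_comm, ← mul_assoc, qPow_mul_mulMonomial, mul_one, smul_mul_assoc,
    mul_assoc, ← qPow_add]
  congr 2
  refine qPow_congr η fun e => ?_
  rw [h]
  ring

theorem TVal_add_wExpo (c : Site → ℂ) (m n : ℤ) (e : Expo) :
    -TVal c m n (e + wExpo 0 m n) =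
      -TVal c m n e + hVal c (m, true) 0 e - hVal c (n, false) 0 e + 2 := by
  simp [TVal, hVal, h1Val, dVal, sgn, wExpo]
  ring

theorem isUnit_wTwisted {η : ℂ} (hη : η.re < 0) (c : Site → ℂ) (m n : ℤ) :
    IsUnit (wTwisted η c m n) := by
  rw [wTwisted_eq]
  exact (isUnit_mulSeries_wSeries hη 0 m n).mul (isUnit_qPow _ _)

theorem constantCoeff_wSeries_sub (η : ℂ) (i : Fin 2) (m n : ℤ) :
    constantCoeff (wSeries η i m n - q η • 1) ≠ 0 := by
  simp [constantCoeff_wSeries, q_ne_zero]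

theorem mulSeries_wSeries_sub (η : ℂ) (i : Fin 2) (m n : ℤ) :
    mulSeries (wSeries η i m n - q η • 1) = mulSeries (wSeries η i m n) - q η • (1 : Op) := by
  rw [map_sub, map_smul, map_one]

theorem isUnit_mulSeries_wSeries_sub (η : ℂ) (i : Fin 2) (m n : ℤ) :
    IsUnit (mulSeries (wSeries η i m n) - q η • (1 : Op)) := by
  rw [← mulSeries_wSeries_sub]
  exact isUnit_mulSeries (constantCoeff_wSeries_sub η i m n)

theorem mul_sub_smul {A B B' C C' : Op} (hB : A * B = B' * A) (hC : A * C = C' * A) (a : ℂ) :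
    A * (B - a • C) = (B' - a • C') * A := by
  refine LinearMap.ext fun f => ?_
  change A (B f - a • C f) = B' (A f) - a • C' (A f)
  rw [map_sub, map_smul]
  exact congrArg₂ (fun x y => x - a • y) (LinearMap.congr_fun hB f) (LinearMap.congr_fun hC f)

/-- The diagonal part of `R η c m n` conjugates this operator to multiplication by `wSeries η 0 m n
- q η • 1`, a series with nonzero constant term. -/
theorem isUnit_wTwisted_sub (η : ℂ) (c : Site → ℂ) (m n : ℤ) :
    IsUnit (wTwisted η c m n - q η • (1 : Op)) := by
  have h := mul_sub_smul (qPow_mul_wTwisted (η := η) (φ := fun e => -TVal c m n e) (TVal_add_wExpo c m n))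
    ((mul_one _).trans (one_mul _).symm) (q η)
  have hD := isUnit_qPow η fun e => -TVal c m n e
  have hu := (isUnit_mulSeries_wSeries_sub η 0 m n).mul hD
  rw [← h] at hu
  exact hD.unit.isUnit_units_mul _ |>.mp hu

theorem Phi_add {c : Site → ℂ} {r : ℤ} {g : Expo} (s : Finset ℤ)
    (hm : ∀ n ∉ s, ∀ i, g ((n + r, true), i) = 0) (hn : ∀ n ∉ s, ∀ i, g ((n, false), i) = 0)
    (e : Expo) :
    Phi c r (e + g) = Phi c r e + ∑ n ∈ s, (-TVal c (n + r) n (e + g) - -TVal c (n + r) n e) := by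
  rw [← sub_eq_iff_eq_add', Phi, Phi, ← (summable_TVal c r _).tsum_sub (summable_TVal c r _)]
  refine tsum_eq_sum fun n h => ?_
  rw [TVal_congr (e' := e), sub_self] <;> intro i
  · simp [hm n h i]
  · simp [hn n h i]

theorem Phi_add_wExpo (c : Site → ℂ) (r n : ℤ) (e : Expo) :
    Phi c r (e + wExpo 0 (n + r) n) =
      Phi c r e + hVal c (n + r, true) 0 e - hVal c (n, false) 0 e + 2 := by
  rw [Phi_add {n} ?_ ?_, Finset.sum_singleton, TVal_add_wExpo]
  · ring
  all_goals
    intro j hj i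
    have : n ≠ j := by rintro rfl; simp at hj
    simp [wExpo, this]

theorem Phi_add_delta (c : Site → ℂ) (r n : ℤ) (e : Expo) :
    Phi c r (e + (wExpo 0 (n + r) n + wExpo 1 (n + r) n)) =
      Phi c r e + c (n + r, true) - c (n, false) := by
  rw [Phi_add {n} ?_ ?_, Finset.sum_singleton]
  · simp [TVal, h1Val, dVal, sgn, wExpo]
    ring
  all_goals
    intro j hj i
    have : n ≠ j := by rintro rfl; simp at hj
    simp [wExpo, this]

/-- The added monomial lives at `(n + r)⁺` and `(m - r)⁻`, whose partners in the product are `n⁻`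
and `m⁺`. So two summands change, and together they undo the diagonal part of `wTwisted η c m n` up
to a constant. -/
theorem Phi_add_wExpo_cross (c : Site → ℂ) {r m n : ℤ} (h : m ≠ n + r) (e : Expo) :
    Phi c r (e + wExpo 0 (n + r) (m - r)) =
      Phi c r e + (hVal c (m, true) 0 e - hVal c (n, false) 0 e) := by
  have hne : n ≠ m - r := by omega
  rw [Phi_add {n, m - r} ?_ ?_, Finset.sum_pair hne]
  · simp [TVal, hVal, h1Val, dVal, sgn, wExpo, hne, h]
    ring
  all_goals
    intro j hj i
    simp only [Finset.mem_insert, Finset.mem_singleton, not_or] at hj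
    simp [wExpo, Ne.symm hj.1, Ne.symm hj.2]

/-! ### Effect of rescaling on the series of the `R` matrices -/

theorem rescale_eSeries (t : Site × Fin 2 → ℂ) (η : ℂ) (s : Site) (i : Fin 2) :
    rescale t (eSeries η s i) = t (s, i) • eSeries η s i := by
  classical
  rw [eSeries, rescale_smul, smul_comm]
  congr 1
  ext p
  rw [coeff_rescale, map_smul, coeff_X]
  split_ifs with h <;> simp [h]

theorem rescale_wSeries (t : Site × Fin 2 → ℂ) (η : ℂ) (i : Fin 2) (m n : ℤ) :
    rescale t (wSeries η i m n) = (t ((m, true), i) * t ((n, false), i)) • wSeries η i m n := by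
  rw [wSeries, map_mul, rescale_eSeries, rescale_eSeries, smul_mul_smul_comm]

theorem rSeries_mul {η : ℂ} (hη : η.re < 0) (m n : ℤ) :
    rSeries η m n * (poch (q η ^ 2) (q η • wSeries η 1 m n) *
      poch (q η ^ 4) (q η ^ 2 • deltaSeries η m n) *
      poch (q η ^ 2) (q η • wSeries η 0 m n)) = 1 := by
  have h1 := MvPowerSeries.inv_mul_cancel (poch (q η ^ 2) (q η • wSeries η 1 m n))
    (by rw [constantCoeff_poch_wSeries hη]; exact one_ne_zero)
  have h2 := MvPowerSeries.inv_mul_cancel (poch (q η ^ 4) (q η ^ 2 • deltaSeries η m n))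
    (by rw [constantCoeff_poch_deltaSeries hη]; exact one_ne_zero)
  have h3 := MvPowerSeries.inv_mul_cancel (poch (q η ^ 2) (q η • wSeries η 0 m n))
    (by rw [constantCoeff_poch_wSeries hη]; exact one_ne_zero)
  rw [rSeries]
  generalize (poch (q η ^ 2) (q η • wSeries η 1 m n))⁻¹ = a at *
  generalize (poch (q η ^ 4) (q η ^ 2 • deltaSeries η m n))⁻¹ = b at *
  generalize (poch (q η ^ 2) (q η • wSeries η 0 m n))⁻¹ = d at *
  linear_combination (b * poch (q η ^ 4) (q η ^ 2 • deltaSeries η m n) * d *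
    poch (q η ^ 2) (q η • wSeries η 0 m n)) * h1 +
    (d * poch (q η ^ 2) (q η • wSeries η 0 m n)) * h2 + h3

/-- The opposite scalings of `w_0` and `w_1` cancel in `Δ`, so the middle Pochhammer symbol is
unaffected. -/
theorem rescale_rSeries_mul {η : ℂ} (hη : η.re < 0) {t : Site × Fin 2 → ℂ} {m n : ℤ} {a : ℂ}
    (ha : a ≠ 0) (h0 : t ((m, true), 0) * t ((n, false), 0) = a⁻¹)
    (h1 : t ((m, true), 1) * t ((n, false), 1) = a) :
    rescale t (rSeries η m n) * (poch (q η ^ 2) (q η • a • wSeries η 1 m n) *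
      poch (q η ^ 4) (q η ^ 2 • deltaSeries η m n) *
      poch (q η ^ 2) (q η • a⁻¹ • wSeries η 0 m n)) = 1 := by
  have hq2 := norm_q_pow_lt_one hη two_ne_zero
  have hq4 := norm_q_pow_lt_one hη four_ne_zero
  have h := congrArg (rescale t) (rSeries_mul hη m n)
  have hd : rescale t (deltaSeries η m n) = deltaSeries η m n := by
    rw [deltaSeries, map_mul, rescale_wSeries, rescale_wSeries, h0, h1, smul_mul_smul_comm,
      inv_mul_cancel₀ ha, one_smul]
  rwa [map_mul, map_mul, map_mul, map_one, rescale_poch hq2 (constantCoeff_smul_wSeries ..),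
    rescale_poch hq4 (constantCoeff_smul_deltaSeries ..),
    rescale_poch hq2 (constantCoeff_smul_wSeries ..), rescale_smul, rescale_smul, rescale_smul,
    rescale_wSeries, rescale_wSeries, h0, h1, hd] at h

theorem rescale_rSeries_of_eq_one {η : ℂ} (hη : η.re < 0) {t : Site × Fin 2 → ℂ} {m n : ℤ}
    (h : ∀ i, t ((m, true), i) * t ((n, false), i) = 1) :
    rescale t (rSeries η m n) = rSeries η m n := by
  have h1 := rescale_rSeries_mul hη one_ne_zero (by rw [h, inv_one]) (h 1)
  rw [inv_one, one_smul, one_smul] at h1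
  have h2 := rSeries_mul hη m n
  rw [mul_comm] at h2
  exact left_inv_eq_right_inv h1 h2

/-- Scaling by `q ^ (∓2)` moves each outer symbol by one step of `poch_eq`: `(q⁻¹ w_0)_∞ = (1 - q⁻¹
w_0) (q w_0)_∞` and `(q w_1)_∞ = (1 - q w_1) (q³ w_1)_∞`. -/
theorem rescale_rSeries_mul_one_sub {η : ℂ} (hη : η.re < 0) {t : Site × Fin 2 → ℂ} {m n : ℤ}
    (h0 : t ((m, true), 0) * t ((n, false), 0) = (q η ^ 2)⁻¹)
    (h1 : t ((m, true), 1) * t ((n, false), 1) = q η ^ 2) :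
    rescale t (rSeries η m n) * (1 - (q η)⁻¹ • wSeries η 0 m n) =
      rSeries η m n * (1 - q η • wSeries η 1 m n) := by
  have hq := q_ne_zero η
  have hq2 := norm_q_pow_lt_one hη two_ne_zero
  have hr := rSeries_mul hη m n
  have hr' := rescale_rSeries_mul hη (pow_ne_zero 2 hq) h0 h1
  have e0 : q η • (q η ^ 2)⁻¹ • wSeries η 0 m n = (q η)⁻¹ • wSeries η 0 m n := by
    rw [smul_smul]
    congr 1
    field_simp
  have p0 := poch_eq hq2 (constantCoeff_smul_wSeries η 0 m n (q η)⁻¹)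
  have p1 := poch_eq hq2 (constantCoeff_smul_wSeries η 1 m n (q η))
  have e1 : q η ^ 2 • (q η)⁻¹ • wSeries η 0 m n = q η • wSeries η 0 m n := by
    rw [smul_smul]
    congr 1
    field_simp
  rw [e1] at p0
  rw [smul_comm] at p1
  rw [e0, p0] at hr'
  rw [p1] at hr
  linear_combination (rSeries η m n * (1 - q η • wSeries η 1 m n)) * hr' -
    (rescale t (rSeries η m n) * (1 - (q η)⁻¹ • wSeries η 0 m n)) * hr

theorem hasProd_mul_eq_of_pair {ι : Type*} {f g : ι → Series} {F G : Series}
    (hf : HasProd f F) (hg : HasProd g G) {a b : ι} (hab : a ≠ b)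
    (h : ∀ n, n ≠ a → n ≠ b → f n = g n) {A A' B B' : Series} (ha : f a * A = g a * A')
    (hb : f b * B = g b * B') : F * (A * B) = G * (A' * B') := by
  classical
  refine tendsto_nhds_unique_of_eventuallyEq (hf.mul_const (A * B)) (hg.mul_const (A' * B')) ?_
  filter_upwards [eventually_ge_atTop {a, b}] with s hs
  rw [← Finset.prod_sdiff hs, ← Finset.prod_sdiff hs, Finset.prod_pair hab, Finset.prod_pair hab]
  have : ∏ n ∈ s \ {a, b}, f n = ∏ n ∈ s \ {a, b}, g n := by
    refine Finset.prod_congr rfl fun n hn => ?_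
    simp only [Finset.mem_sdiff, Finset.mem_insert, Finset.mem_singleton, not_or] at hn
    exact h n hn.2.1 hn.2.2
  rw [this]
  linear_combination (∏ n ∈ s \ {a, b}, g n) * (f b * B) * ha +
    (∏ n ∈ s \ {a, b}, g n) * (g a * A') * hb

/-- The power series `(w_0 - q Δ) / (w_0 - q)` at the points `m⁺`, `n⁻`. -/
def ratioSeries (η : ℂ) (m n : ℤ) : Series :=
  (wSeries η 0 m n - q η • deltaSeries η m n) * (wSeries η 0 m n - q η • 1)⁻¹

/-- From `w_0 - q Δ = w_0 (1 - q w_1)` and `w_0 - q = -q (1 - q⁻¹ w_0)`; this matches the ratios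
with the linear factors of `rescale_rSeries_mul_one_sub`. -/
theorem ratioSeries_mul (η : ℂ) (m n : ℤ) :
    ratioSeries η m n * (-q η • (1 - (q η)⁻¹ • wSeries η 0 m n)) =
      wSeries η 0 m n * (1 - q η • wSeries η 1 m n) := by
  have h : -q η • (1 - (q η)⁻¹ • wSeries η 0 m n) = wSeries η 0 m n - q η • 1 := by
    rw [smul_sub, smul_smul, neg_mul, mul_inv_cancel₀ (q_ne_zero η)]
    module
  rw [h, ratioSeries, mul_assoc,
    MvPowerSeries.inv_mul_cancel _ (constantCoeff_wSeries_sub η 0 m n), mul_one, deltaSeries,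
    mul_sub, mul_one, mul_smul_comm]

/-- The scale factors of the variables under conjugation by `k_0⁻¹ ⊗ k_0` at `m⁺`, `n⁻`. -/
def twist (η : ℂ) (m n : ℤ) (s : Site × Fin 2) : ℂ :=
  if s.1 = (m, true) ∨ s.1 = (n, false) then if s.2 = 0 then (q η ^ 2)⁻¹ else q η ^ 2 else 1

/-- The twist meets the product only in the factors `j = n` (through `n⁻`) and `j = m - r` (through
`m⁺`). Each contributes `(1 - q w_1) / (1 - q⁻¹ w_0)`, that is, `-q / w_0` times a ratio. The
resulting `q ^ 2` cancels the prefactor, and the two `w_0` cancel against the crossed pair by `hww`.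
-/
theorem rescale_tprod_rSeries {η : ℂ} (hη : η.re < 0) {r m n : ℤ} (h : m ≠ n + r) :
    (q η ^ 2)⁻¹ • (wSeries η 0 m n * rescale (twist η m n)
      ((∏' j : ℤ, rSeries η (j + r) j) * wSeries η 0 (n + r) (m - r))) =
    ratioSeries η m (m - r) * ratioSeries η (n + r) n * ∏' j : ℤ, rSeries η (j + r) j := by
  have hne : n ≠ m - r := by omega
  have hm := multipliable_rSeries hη r
  have hF := hasProd_mul_eq_of_pair (rescale_tprod hm (twist η m n)) hm.hasProd hne
    (fun j hj hj' => rescale_rSeries_of_eq_one hη fun i => by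
      have : j + r ≠ m := by omega
      simp [twist, hj, this])
    (rescale_rSeries_mul_one_sub hη (by simp [twist, h.symm]) (by simp [twist, h.symm]))
    (rescale_rSeries_mul_one_sub hη (by simp [twist, hne.symm]) (by simp [twist, hne.symm]))
  have hw : rescale (twist η m n) (wSeries η 0 (n + r) (m - r)) = wSeries η 0 (n + r) (m - r) := by
    rw [rescale_wSeries]
    simp [twist, h.symm, hne.symm]
  have hww : wSeries η 0 m n * wSeries η 0 (n + r) (m - r) =
      wSeries η 0 m (m - r) * wSeries η 0 (n + r) n := by
    simp only [wSeries]
    ring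
  have r1 := ratioSeries_mul η m (m - r)
  have r2 := ratioSeries_mul η (n + r) n
  rw [sub_add_cancel] at hF
  rw [map_mul, hw, inv_smul_eq_iff₀ (pow_ne_zero 2 (q_ne_zero η))]
  generalize (∏' j : ℤ, rSeries η (j + r) j) = F at hF ⊢
  have hB : ∀ m' n', (1 - (q η)⁻¹ • wSeries η 0 m' n') ≠ 0 := fun m' n' h0 => by
    have := congrArg constantCoeff h0
    simp [constantCoeff_wSeries] at this
  -- Clearing the denominators `1 - q⁻¹ w_0` leaves a polynomial identity.
  refine mul_right_cancel₀ (mul_ne_zero (hB (n + r) n) (hB m (m - r))) ?_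
  generalize rescale (twist η m n) F = F' at *
  simp only [smul_eq_C_mul, map_neg, map_pow] at *
  generalize C (σ := Site × Fin 2) (q η) = k at *
  generalize C (σ := Site × Fin 2) (q η)⁻¹ = k' at *
  linear_combination (wSeries η 0 m n * wSeries η 0 (n + r) (m - r)) * hF +
    F * (1 - k * wSeries η 1 m (m - r)) * (1 - k * wSeries η 1 (n + r) n) * hww -
    F * (wSeries η 0 (n + r) n * (1 - k * wSeries η 1 (n + r) n)) * r1 -
    F * (ratioSeries η m (m - r) * (-k * (1 - k' * wSeries η 0 m (m - r)))) * r2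

theorem exp_neg_two_mul (η : ℂ) : Complex.exp (η * -2) = (q η ^ 2)⁻¹ := by
  rw [q, ← Complex.exp_nat_mul, ← Complex.exp_neg]
  congr 1
  push_cast
  ring

theorem exp_two_mul (η : ℂ) : Complex.exp (η * 2) = q η ^ 2 := by
  rw [q, ← Complex.exp_nat_mul, mul_comm]
  norm_cast

theorem exp_twist (η : ℂ) (c : Site → ℂ) (m n : ℤ) (e : Expo) (s : Site × Fin 2) :
    Complex.exp (η * (-hVal c (m, true) 0 (e + Finsupp.single s 1) +
        hVal c (n, false) 0 (e + Finsupp.single s 1) - 2)) =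
      twist η m n s * Complex.exp (η * (-hVal c (m, true) 0 e + hVal c (n, false) 0 e - 2)) := by
  have key : ∀ a b : ℂ, Complex.exp (η * a) = b →
      -hVal c (m, true) 0 (e + Finsupp.single s 1) + hVal c (n, false) 0 (e + Finsupp.single s 1)
        - 2 = a + (-hVal c (m, true) 0 e + hVal c (n, false) 0 e - 2) → twist η m n s = b →
      Complex.exp (η * (-hVal c (m, true) 0 (e + Finsupp.single s 1) +
        hVal c (n, false) 0 (e + Finsupp.single s 1) - 2)) =
      twist η m n s * Complex.exp (η * (-hVal c (m, true) 0 e + hVal c (n, false) 0 e - 2)) := by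
    intro a b hb h ht
    rw [h, ht, mul_add, Complex.exp_add, hb]
  obtain ⟨s, i⟩ := s
  by_cases hs : s = (m, true) ∨ s = (n, false)
  · match i with
    | 0 =>
      refine key (-2) _ (exp_neg_two_mul η) ?_ (by simp [twist, hs])
      rcases hs with rfl | rfl <;> simp [hVal, h1Val, sgn] <;> ring
    | 1 =>
      refine key 2 _ (exp_two_mul η) ?_ (by simp [twist, hs])
      rcases hs with rfl | rfl <;> simp [hVal, h1Val, sgn] <;> ring
  · refine key 0 1 (by simp) ?_ (by simp [twist, hs])
    rw [not_or] at hs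
    simp [hVal, h1Val, sgn, hs.1, hs.2]

/-! ### Exchange relations with the infinite products -/

theorem wTwisted_mul_HProd_mul {η : ℂ} (hη : η.re < 0) (c : Site → ℂ) {r m n : ℤ}
    (h : m ≠ n + r) :
    wTwisted η c m n * HProd η c r * mulSeries (wSeries η 0 (n + r) (m - r)) =
      mulSeries (ratioSeries η m (m - r) * ratioSeries η (n + r) n) * HProd η c r := by
  have hD : qPow η (Phi c r) * mulSeries (wSeries η 0 (n + r) (m - r)) =
      mulSeries (wSeries η 0 (n + r) (m - r)) *
        qPow η fun e => Phi c r e + (hVal c (m, true) 0 e - hVal c (n, false) 0 e) := by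
    rw [mulSeries_wSeries, mul_smul_comm, smul_mul_assoc, qPow_mul_mulMonomial]
    simp only [Phi_add_wExpo_cross c h]
  have hψ := qPow_mul_mulSeries (η := η) (t := twist η m n)
    (ψ := fun e => -hVal c (m, true) 0 e + hVal c (n, false) 0 e - 2) (exp_twist η c m n)
    ((∏' j : ℤ, rSeries η (j + r) j) * wSeries η 0 (n + r) (m - r))
  -- The twist cancels the cross shift of `Phi`; only the scalar `q ^ (-2)` survives.
  have hψ' : (qPow η fun e => -hVal c (m, true) 0 e + hVal c (n, false) 0 e - 2) *
      (qPow η fun e => Phi c r e + (hVal c (m, true) 0 e - hVal c (n, false) 0 e)) =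
      (q η ^ 2)⁻¹ • qPow η (Phi c r) := by
    rw [← exp_neg_two_mul, ← one_mul (qPow η (Phi c r)), ← smul_mul_assoc, ← qPow_const,
      ← qPow_add, ← qPow_add]
    refine qPow_congr η fun e => ?_
    ring
  have hs := rescale_tprod_rSeries hη h
  rw [HProd_eq hη, wTwisted_eq, ← mul_assoc (mulSeries (_ * _)), ← map_mul, ← hs]
  generalize (∏' j : ℤ, rSeries η (j + r) j) = F at *
  rw [map_smul, smul_mul_assoc, ← mul_smul_comm, ← hψ', map_mul mulSeries (wSeries η 0 m n),
    mul_assoc (mulSeries (wSeries η 0 m n)) (mulSeries (rescale _ _)),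
    ← mul_assoc (mulSeries (rescale _ _)), ← hψ, map_mul]
  simp only [mul_assoc, hD]

theorem HProd_mul_of_qPow_mul {η : ℂ} (hη : η.re < 0) {c : Site → ℂ} {r : ℤ} {F : Series} {A : Op}
    (h : qPow η (Phi c r) * A = mulSeries F * qPow η (Phi c r)) :
    HProd η c r * A = mulSeries F * HProd η c r := by
  rw [HProd_eq hη, mul_assoc, h, ← mul_assoc, ← mul_assoc, ← map_mul, ← map_mul, mul_comm F]

theorem HProd_mul_wTwisted {η : ℂ} (hη : η.re < 0) (c : Site → ℂ) (r n : ℤ) :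
    HProd η c r * wTwisted η c (n + r) n = mulSeries (wSeries η 0 (n + r) n) * HProd η c r :=
  HProd_mul_of_qPow_mul hη (qPow_mul_wTwisted (Phi_add_wExpo c r n))

theorem mul_inverse_of_mul_eq {D V W : Op} (hV : IsUnit V) (hW : IsUnit W)
    (h : D * V = W * D) : D * Ring.inverse V = Ring.inverse W * D := by
  rw [eq_comm, Ring.inverse_mul_eq_iff_eq_mul _ _ _ hW, ← mul_assoc, ← h,
    Ring.mul_inverse_cancel_right _ _ hV]

theorem mulSeries_ratioSeries (η : ℂ) (m n : ℤ) :
    mulSeries (ratioSeries η m n) =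
      (mulSeries (wSeries η 0 m n) - q η • mulSeries (deltaSeries η m n)) *
        Ring.inverse (mulSeries (wSeries η 0 m n) - q η • (1 : Op)) := by
  rw [← mulSeries_wSeries_sub, inverse_mulSeries (constantCoeff_wSeries_sub η 0 m n), ratioSeries,
    map_mul, map_sub, map_smul]

theorem w_of_modEq {m n : ℤ} (h : m ≡ n [ZMOD 2]) (η : ℂ) (c : Site → ℂ) :
    w η c 0 m n = mulSeries (wSeries η 0 m n) := by
  rw [w, if_pos h, E_mul_E]

theorem w_of_not_modEq {m n : ℤ} (h : ¬ m ≡ n [ZMOD 2]) (η : ℂ) (c : Site → ℂ) :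
    w η c 0 m n = wTwisted η c m n := by
  rw [w, if_neg h, wTwisted]

theorem ratio_of_modEq {m n : ℤ} (h : m ≡ n [ZMOD 2]) (η : ℂ) (c : Site → ℂ) :
    ratio η c m n = mulSeries (ratioSeries η m n) := by
  rw [ratio, w_of_modEq h, Delta, if_pos h, DeltaAt_mul_DeltaAt, mulSeries_ratioSeries]

/-- For odd `r`, the power of `q` in `Delta` is the one that `Phi_add_delta` removes, so numerator
and denominator are intertwined with their plain versions. -/
theorem HProd_mul_ratio {η : ℂ} (hη : η.re < 0) (c : Site → ℂ) {r n : ℤ}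
    (h : ¬ n + r ≡ n [ZMOD 2]) :
    HProd η c r * ratio η c (n + r) n = mulSeries (ratioSeries η (n + r) n) * HProd η c r := by
  have hw := HProd_mul_wTwisted hη c r n
  have hd := HProd_mul_of_qPow_mul hη (qPow_mul_smul_deltaSeries (η := η) (Phi_add_delta c r n))
  have h1 := mul_sub_smul hw hd (q η)
  have h2 := mul_inverse_of_mul_eq (isUnit_wTwisted_sub η c _ _)
    (isUnit_mulSeries_wSeries_sub η 0 _ _)
    (mul_sub_smul hw ((mul_one _).trans (one_mul _).symm) (q η))
  rw [ratio, w_of_not_modEq h, Delta, if_neg h, DeltaAt_mul_DeltaAt, mulSeries_ratioSeries,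
    ← mul_assoc, h1, mul_assoc, h2, mul_assoc]

end QLattice

end

theorem theorem1 (η : ℂ) (hη : η.re < 0) (c : QLattice.Site → ℂ) :
    (∀ m n : ℤ, IsUnit (QLattice.R η c m n)) ∧
    (∀ r : ℤ, (∃ L, QLattice.TendstoOp (QLattice.HTrunc η c r) L) ∧
      IsUnit (QLattice.HProd η c r)) ∧
    (∀ m n : ℤ, IsUnit (QLattice.w η c 0 m n) ∧
      IsUnit (QLattice.w η c 0 m n - QLattice.q η • (1 : QLattice.Op))) ∧
    ∀ m : ℤ,
      QLattice.evol η c (QLattice.w η c 0 m m) =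
        QLattice.ratio η c m (m - 1) * QLattice.ratio η c (m + 1) m *
          Ring.inverse (QLattice.w η c 0 (m + 1) (m - 1)) ∧
      QLattice.evolInv η c (QLattice.w η c 0 (m + 1) m) =
        Ring.inverse (QLattice.w η c 0 m (m + 1)) *
          (QLattice.ratio η c m m * QLattice.ratio η c (m + 1) (m + 1)) := by
  open QLattice in
  have hH : IsUnit (H η c) := (isUnit_HProd hη c 0).mul (isUnit_HProd hη c 1)
  refine ⟨isUnit_R hη c, fun r => ⟨⟨_, tendstoOp_HTrunc hη c r⟩, isUnit_HProd hη c r⟩,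
    fun m n => ?_, fun m => ⟨?_, ?_⟩⟩
  · by_cases h : m ≡ n [ZMOD 2]
    · rw [w_of_modEq h]
      exact ⟨isUnit_mulSeries_wSeries hη 0 m n, isUnit_mulSeries_wSeries_sub η 0 m n⟩
    · rw [w_of_not_modEq h]
      exact ⟨isUnit_wTwisted hη c m n, isUnit_wTwisted_sub η c m n⟩
  · have h0 := HProd_mul_wTwisted hη c 0 m
    -- Here `wTwisted η c m m` is only an intermediate operator, what `w η c 0 m m` becomes after
    -- passing `H_0`; equal parity makes the dynamical variable itself untwisted.
    have h1 := wTwisted_mul_HProd_mul hη c (r := 1) (m := m) (n := m) (by omega)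
    have r1 := HProd_mul_ratio hη c (r := 1) (n := m - 1) (by rw [Int.ModEq]; omega)
    have r2 := HProd_mul_ratio hη c (r := 1) (n := m) (by rw [Int.ModEq]; omega)
    rw [add_zero] at h0
    rw [sub_add_cancel] at r1
    rw [evol, mul_assoc, Ring.inverse_mul_eq_iff_eq_mul _ _ _ hH, w_of_modEq rfl,
      w_of_modEq (show m + 1 ≡ m - 1 [ZMOD 2] by rw [Int.ModEq]; omega), ← mul_assoc (H η c),
      Ring.eq_mul_inverse_iff_mul_eq _ _ _ (isUnit_mulSeries_wSeries hη 0 _ _), H,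
      ← mul_assoc (mulSeries _), ← h0, mul_assoc (HProd η c 0), mul_assoc (HProd η c 0), h1,
      mul_assoc (HProd η c 0), ← mul_assoc (HProd η c 1), r1, mul_assoc (mulSeries _), r2,
      ← mul_assoc (mulSeries _), ← map_mul]
  · have h0 := HProd_mul_wTwisted hη c 1 m
    -- With `r = 0` the crossed pair is `(m + 1)⁺`, `m⁻`, which is where `h0` puts the plain
    -- variable after passing `H_1`.
    have h1 := wTwisted_mul_HProd_mul hη c (r := 0) (m := m) (n := m + 1) (by omega)
    rw [add_zero, sub_zero] at h1
    rw [evolInv, eq_comm, Ring.eq_mul_inverse_iff_mul_eq _ _ _ hH, mul_assoc (Ring.inverse _),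
      w_of_not_modEq (show ¬ m ≡ m + 1 [ZMOD 2] by rw [Int.ModEq]; omega),
      Ring.inverse_mul_eq_iff_eq_mul _ _ _ (isUnit_wTwisted hη c _ _),
      w_of_not_modEq (show ¬ m + 1 ≡ m [ZMOD 2] by rw [Int.ModEq]; omega),
      ratio_of_modEq rfl, ratio_of_modEq rfl, ← map_mul, H, ← mul_assoc (mulSeries _), ← h1,
      mul_assoc (HProd η c 0), h0]
    simp only [mul_assoc]
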